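/- Let $(X,Y)$ be an $\mathbb{R}^2$-valued random vector on a probability space $(\Omega,\mathcal F,\mathbb P)$ whose marginal distribution functions $F_X,F_Y$ are continuous and invertible (onto $(0,1)$, from the points where they take values in $(0,1)$), with quantile functions $Q_X=F_X^{-1}$, $Q_Y=F_Y^{-1}$ on $(0,1)$. Fix $0<p_1<q_1<1$ and $0<p_2<q_2<1$, put $$A=[Q_X(p_1),Q_X(q_1)]\times[Q_Y(p_2),Q_Y(q_2)],$$ and assume $\mathbb P[(X,Y)\in A]>0$. Write $\mu_A(Z)=\mathbb E[Z\mid (X,Y)\in A]$, $\sigma_A^2(Z)=\mathbb E[(Z-\mu_A(Z))^2\mid (X,Y)\in A]$ for $Z\in\{X,Y\}$, $\mathrm{cov}_A(X,Y)=\mathbb E[(X-\mu_A(X))(Y-\mu_A(Y))\mid (X,Y)\in A]$ and $$\mathrm{cor}_A(X,Y)=\frac{\mathrm{cov}_A(X,Y)}{\sqrt{\sigma_A^2(X)\sigma_A^2(Y)}}.$$ Let $(X_i,Y_i)_{i\ge1}$ be i.i.d. copies of $(X,Y)$. For $n\ge1$ let $N_n=\sum_{i=1}^n 1_A(X_i,Y_i)$,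 $$\bar\mu_A(\mathbf Z)=\frac1{N_n}\sum_{i=1}^n Z_i1_A(X_i,Y_i),\qquad \bar\sigma^2_A(\mathbf Z)=\frac1{N_n}\sum_{i=1}^n (Z_i-\bar\mu_A(\mathbf Z))^21_A(X_i,Y_i)$$ for $\mathbf Z=\mathbf X$ and $\mathbf Z=\mathbf Y$, $$\overline{\mathrm{cov}}_A(\mathbf X,\mathbf Y)=\frac1{N_n}\sum_{i=1}^n (X_i-\bar\mu_A(\mathbf X))(Y_i-\bar\mu_A(\mathbf Y))1_A(X_i,Y_i),\qquad \overline{\mathrm{cor}}_A(\mathbf X,\mathbf Y)=\frac{\overline{\mathrm{cov}}_A(\mathbf X,\mathbf Y)}{\sqrt{\bar\sigma^2_A(\mathbf X)\,\bar\sigma^2_A(\mathbf Y)}},$$ where a quotient with denominator $0$ is read as $0$. Then there is $\tau\ge0$ such that $$\sqrt n\,\bigl(\overline{\mathrm{cor}}_A(\mathbf X,\mathbf Y)-\mathrm{cor}_A(X,Y)\bigr)\xrightarrow{d}\mathcal N(0,\tau),\qquad n\to\infty,$$ where $\mathcal N(0,\tau)$ is the normal law with mean $0$ and variance $\tau$ (the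 point mass at $0$ if $\tau=0$). Moreover $\tau>0$ unless the conditional law of $(X,Y)$ on $A$ is degenerate in the following sense, in which case $\tau=0$: with $U=(X-\mu_A(X))/\sigma_A(X)$ and $V=(Y-\mu_A(Y))/\sigma_A(Y)$, there is a real $t$ such that, conditionally on $(X,Y)\in A$, almost surely $V=tU$ or $U=tV$. (For $t=\pm1$ this is perfect linear dependence of $X$ and $Y$ on $A$. It cannot occur, for instance, if $(X,Y)$ has a density.) -/

import Mathlib

open MeasureTheory ProbabilityTheory Filter

noncomputable section

namespace QuantileCor

/-- The distribution function of a real random variable. -/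
def distFun {Ω : Type*} [MeasurableSpace Ω] (P : Measure Ω) (Z : Ω → ℝ) (x : ℝ) : ℝ :=
  cdf (P.map Z) x

/-- The distribution function of `Z` is continuous, and invertible as a map onto `(0,1)`
from the points where it takes values in `(0,1)`. The case where it is a bijection from the
whole real line onto `(0,1)` is included, and so are distributions such as the uniform one. -/
def ContinuousInvertible {Ω : Type*} [MeasurableSpace Ω] (P : Measure Ω) (Z : Ω → ℝ) : Prop :=
  Continuous (distFun P Z) ∧
    Set.BijOn (distFun P Z) {x | distFun P Z x ∈ Set.Ioo (0 : ℝ) 1} (Set.Ioo 0 1)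

/-- The quantile function `inf {x | p ≤ F_Z(x)}`; for `0 < p < 1` it is the inverse of `F_Z`
whenever `F_Z` is continuous and invertible (see `quantile_eq`). -/
def quantile {Ω : Type*} [MeasurableSpace Ω] (P : Measure Ω) (Z : Ω → ℝ) (p : ℝ) : ℝ :=
  sInf {x | p ≤ distFun P Z x}

theorem quantile_eq {Ω : Type*} [MeasurableSpace Ω] (P : Measure Ω) (Z : Ω → ℝ)
    (h : ContinuousInvertible P Z) {p : ℝ} (hp : p ∈ Set.Ioo (0 : ℝ) 1) (x : ℝ) :
    distFun P Z x = p ↔ x = quantile P Z p := by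
  have hmono : Monotone (distFun P Z) := monotone_cdf _
  have key : ∀ y, distFun P Z y = p → y = quantile P Z p := by
    intro y hy
    have hleast : IsLeast {x | p ≤ distFun P Z x} y := by
      refine ⟨hy.ge, fun z hz => ?_⟩
      by_contra hlt
      have hz' : distFun P Z z = p := le_antisymm (hy ▸ hmono (not_le.mp hlt).le) hz
      have hzy : z = y := h.2.injOn (by simpa [hz'] using hp) (by simpa [hy] using hp)
        (hz'.trans hy.symm)
      exact hlt hzy.ge
    exact hleast.csInf_eq.symm
  refine ⟨key x, fun hx => ?_⟩
  obtain ⟨y, -, hy⟩ := h.2.surjOn hp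
  rw [hx, ← key y hy, hy]

/-- The quantile rectangle `A = [Q_X(p₁), Q_X(q₁)] × [Q_Y(p₂), Q_Y(q₂)]`. -/
def quantileSet {Ω : Type*} [MeasurableSpace Ω] (P : Measure Ω) (X Y : Ω → ℝ)
    (p₁ q₁ p₂ q₂ : ℝ) : Set (ℝ × ℝ) :=
  Set.Icc (quantile P X p₁) (quantile P X q₁) ×ˢ Set.Icc (quantile P Y p₂) (quantile P Y q₂)

/-! Population quantities -/

/-- The conditional probability measure given `(X, Y) ∈ A`. -/
def condMeasure {Ω : Type*} [MeasurableSpace Ω] (P : Measure Ω) (X Y : Ω → ℝ)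
    (A : Set (ℝ × ℝ)) : Measure Ω :=
  ProbabilityTheory.cond P {ω | (X ω, Y ω) ∈ A}

/-- `μ_A(Z) = E[Z | (X,Y) ∈ A]`. -/
def condMean {Ω : Type*} [MeasurableSpace Ω] (P : Measure Ω) (X Y : Ω → ℝ)
    (A : Set (ℝ × ℝ)) (Z : Ω → ℝ) : ℝ :=
  ∫ ω, Z ω ∂(condMeasure P X Y A)

/-- `σ²_A(Z) = E[(Z - μ_A(Z))² | (X,Y) ∈ A]`. -/
def condVar {Ω : Type*} [MeasurableSpace Ω] (P : Measure Ω) (X Y : Ω → ℝ)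
    (A : Set (ℝ × ℝ)) (Z : Ω → ℝ) : ℝ :=
  ∫ ω, (Z ω - condMean P X Y A Z) ^ 2 ∂(condMeasure P X Y A)

/-- `cov_A(X,Y) = E[(X - μ_A(X)) (Y - μ_A(Y)) | (X,Y) ∈ A]`. -/
def condCov {Ω : Type*} [MeasurableSpace Ω] (P : Measure Ω) (X Y : Ω → ℝ)
    (A : Set (ℝ × ℝ)) : ℝ :=
  ∫ ω, (X ω - condMean P X Y A X) * (Y ω - condMean P X Y A Y) ∂(condMeasure P X Y A)

/-- `cor_A(X,Y) = cov_A(X,Y) / √(σ²_A(X) σ²_A(Y))`. -/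
def condCor {Ω : Type*} [MeasurableSpace Ω] (P : Measure Ω) (X Y : Ω → ℝ)
    (A : Set (ℝ × ℝ)) : ℝ :=
  condCov P X Y A / √(condVar P X Y A X * condVar P X Y A Y)

/-- `Z` standardized under the conditional law, `(Z - μ_A(Z)) / √(σ²_A(Z))`. -/
def standardized {Ω : Type*} [MeasurableSpace Ω] (P : Measure Ω) (X Y : Ω → ℝ)
    (A : Set (ℝ × ℝ)) (Z : Ω → ℝ) (ω : Ω) : ℝ :=
  (Z ω - condMean P X Y A Z) / √(condVar P X Y A Z)

/-- Degeneracy of the conditional law of `(X, Y)` on `A`: in the conditionally standardized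
coordinates `(u, v)`, it is carried by the two lines `v = t u` and `u = t v` for some real `t`.
For `t = 1` or `t = -1` the two lines agree: perfect linear dependence on `A`. -/
def Degenerate {Ω : Type*} [MeasurableSpace Ω] (P : Measure Ω) (X Y : Ω → ℝ)
    (A : Set (ℝ × ℝ)) : Prop :=
  ∃ t : ℝ, ∀ᵐ ω ∂(condMeasure P X Y A),
    standardized P X Y A Y ω = t * standardized P X Y A X ω ∨
      standardized P X Y A X ω = t * standardized P X Y A Y ω

/-! Sample quantities for the known set `A`. Division by zero gives zero, so that the sample
mean, variance and covariance vanish when no observation falls into `A`. -/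

/-- `1_A(x_i, y_i)`. -/
def ind {n : ℕ} (A : Set (ℝ × ℝ)) (x y : Fin n → ℝ) (i : Fin n) : ℝ :=
  A.indicator (fun _ => (1 : ℝ)) (x i, y i)

/-- `∑ᵢ 1_A(x_i, y_i)`. -/
def sampleCount {n : ℕ} (A : Set (ℝ × ℝ)) (x y : Fin n → ℝ) : ℝ :=
  ∑ i, ind A x y i

/-- The sample conditional mean of `z`. -/
def sampleMean {n : ℕ} (A : Set (ℝ × ℝ)) (x y z : Fin n → ℝ) : ℝ :=
  1 / sampleCount A x y * ∑ i, z i * ind A x y i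

/-- The sample conditional variance of `z`. -/
def sampleVar {n : ℕ} (A : Set (ℝ × ℝ)) (x y z : Fin n → ℝ) : ℝ :=
  1 / sampleCount A x y * ∑ i, (z i - sampleMean A x y z) ^ 2 * ind A x y i

/-- The sample conditional covariance. -/
def sampleCov {n : ℕ} (A : Set (ℝ × ℝ)) (x y : Fin n → ℝ) : ℝ :=
  1 / sampleCount A x y *
    ∑ i, (x i - sampleMean A x y x) * (y i - sampleMean A x y y) * ind A x y i

/-- The conditional correlation estimator with known set `A`. -/
def sampleCor {n : ℕ} (A : Set (ℝ × ℝ)) (x y : Fin n → ℝ) : ℝ :=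
  sampleCov A x y / √(sampleVar A x y x * sampleVar A x y y)

end QuantileCor

end

/-! Given `A`, let U and V be the conditionally standardized coordinates and m = P(A). The sample
correlation is unchanged by positive affine maps of each coordinate, so it is a function of the
averages of 1, U, V, U², V², UV, each times 1_A (`sampleCor_eq_corOfAverages`). These are bounded,
because `A` is compact.

The delta method is carried out by an exact identity (`corOfAverages_sub`): the error is the average
of W = m⁻¹(UV - ρ/2 (U² + V²)) 1_A plus centred averages whose coefficients tend to 0 almost surely.
The one-dimensional central limit theorem, the strong law and Slutsky's lemma then give the limit
with τ = Var W; no multivariate limit theorem is needed.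

As W has mean 0, τ = 0 exactly when UV = ρ/2 (U² + V²) almost surely on `A`. This quadratic relation
describes the lines v = tu and u = tv with ρ = 2t/(1 + t²) (`ae_mem_lines_iff`). -/

open scoped Topology

noncomputable section

namespace QuantileCor

/-! ### Slutsky-type lemmas -/

section Convergence

variable {Ω : Type*} [MeasurableSpace Ω] {P : Measure Ω} [IsProbabilityMeasure P]

/-- A sequence converging in distribution, multiplied by one that tends to zero almost surely,
tends to zero in probability. -/
theorem tendstoInMeasure_mul_of_tendsto_zero {Ω' : Type*} [MeasurableSpace Ω']
    {P' : Measure Ω'} [IsProbabilityMeasure P'] {T c : ℕ → Ω → ℝ} {Z : Ω' → ℝ}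
    (hT : TendstoInDistribution T atTop Z (fun _ => P) P')
    (hcm : ∀ n, AEMeasurable (c n) P)
    (hc : ∀ᵐ ω ∂P, Tendsto (fun n => c n ω) atTop (𝓝 0)) :
    TendstoInMeasure P (fun n ω => c n ω * T n ω) atTop 0 := by
  have hcM : TendstoInMeasure P c atTop (fun _ => (0 : ℝ)) :=
    tendstoInMeasure_of_tendsto_ae (fun n => (hcm n).aestronglyMeasurable) hc
  have hd := hT.continuous_comp_prodMk_of_tendstoInMeasure_const
    (g := fun p : ℝ × ℝ => p.2 * p.1) (by fun_prop) hcM hcm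
  rw [tendstoInMeasure_iff_norm]
  intro ε hε
  have hE : MeasurableSet {x : ℝ | ε ≤ ‖x‖} := measurableSet_le measurable_const measurable_norm
  -- The limit law is the point mass at 0, which is off the boundary of {ε ≤ |x|}, so the
  -- portmanteau theorem applies to this set.
  have hfr : (P'.map (fun ω => (0 : ℝ) * Z ω)) (frontier {x : ℝ | ε ≤ ‖x‖}) = 0 := by
    rw [Measure.map_apply_of_aemeasurable hd.aemeasurable_limit isClosed_frontier.measurableSet]
    have : (fun ω => (0 : ℝ) * Z ω) ⁻¹' frontier {x : ℝ | ε ≤ ‖x‖} = ∅ := by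
      ext ω
      simp only [zero_mul, Set.mem_preimage, Set.mem_empty_iff_false, iff_false]
      intro h
      have h' := (isClosed_le continuous_const continuous_norm).frontier_subset h
      simp only [Set.mem_ofPred_eq, norm_zero] at h'
      linarith
    rw [this, measure_empty]
  have hlim := ProbabilityMeasure.tendsto_measure_of_null_frontier_of_tendsto' hd.tendsto hfr
  simp only [ProbabilityMeasure.coe_mk] at hlim
  have h0 : (P'.map (fun ω => (0 : ℝ) * Z ω)) {x : ℝ | ε ≤ ‖x‖} = 0 := by
    rw [Measure.map_apply_of_aemeasurable hd.aemeasurable_limit hE]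
    simp [not_le.mpr hε]
  rw [h0] at hlim
  refine hlim.congr fun n => ?_
  rw [Measure.map_apply_of_aemeasurable (hd.forall_aemeasurable n) hE]
  simp

/-- Adding to a sequence that converges in distribution a tight sequence with coefficients
tending to zero does not change the limit. -/
theorem TendstoInDistribution.add_mul_of_tendsto_zero {Ω' Ω'' : Type*} [MeasurableSpace Ω']
    [MeasurableSpace Ω''] {P' : Measure Ω'} [IsProbabilityMeasure P'] {P'' : Measure Ω''}
    [IsProbabilityMeasure P''] {X T c : ℕ → Ω → ℝ} {Z : Ω' → ℝ} {Z' : Ω'' → ℝ}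
    (hX : TendstoInDistribution X atTop Z (fun _ => P) P')
    (hT : TendstoInDistribution T atTop Z' (fun _ => P) P'')
    (hcm : ∀ n, AEMeasurable (c n) P)
    (hc : ∀ᵐ ω ∂P, Tendsto (fun n => c n ω) atTop (𝓝 0)) :
    TendstoInDistribution (fun n ω => X n ω + c n ω * T n ω) atTop Z (fun _ => P) P' := by
  refine tendstoInDistribution_of_tendstoInMeasure_sub _ Z hX ?_ fun n =>
    (hX.forall_aemeasurable n).add ((hcm n).mul (hT.forall_aemeasurable n))
  convert tendstoInMeasure_mul_of_tendsto_zero hT hcm hc using 1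
  ext n ω
  simp

/-- Convergence in distribution is not affected by changes which almost surely concern only
finitely many terms. -/
theorem TendstoInDistribution.congr_eventually {Ω' : Type*} [MeasurableSpace Ω']
    {P' : Measure Ω'} [IsProbabilityMeasure P'] {X Y : ℕ → Ω → ℝ} {Z : Ω' → ℝ}
    (hX : TendstoInDistribution X atTop Z (fun _ => P) P')
    (hY : ∀ n, AEMeasurable (Y n) P)
    (h : ∀ᵐ ω ∂P, ∀ᶠ n in atTop, X n ω = Y n ω) :
    TendstoInDistribution Y atTop Z (fun _ => P) P' := by
  refine tendstoInDistribution_of_tendstoInMeasure_sub _ Z hX ?_ hY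
  refine tendstoInMeasure_of_tendsto_ae
    (fun n => ((hY n).sub (hX.forall_aemeasurable n)).aestronglyMeasurable) ?_
  filter_upwards [h] with ω hω
  refine tendsto_const_nhds.congr' ?_
  filter_upwards [hω] with n hn
  simp [hn]

end Convergence

/-! ### Algebra of the correlation: an exact linearization -/

/-- The correlation coefficient computed from the averages of the six quantities
`1`, `u`, `v`, `u²`, `v²`, `u v` (each restricted to a set). -/
def corOfAverages (k a b aa bb ab : ℝ) : ℝ :=
  (k * ab - a * b) / √((k * aa - a ^ 2) * (k * bb - b ^ 2))

/-- With g² and h² the two variance factors, gh = (g² + h²)/2 - (g - h)²/2. The last square is K(g²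
- h²) with K = (g - h)/(g + h), which is small when g and h are close. Thus the square root is
traded for terms linear in the averages `w`, `a`, `b`, `aa - bb`, with small coefficients except for
the leading 1 on `w`. -/
theorem corOfAverages_sub {k a b aa bb ab ρ m w : ℝ}
    (hG : 0 < k * aa - a ^ 2) (hH : 0 < k * bb - b ^ 2)
    (hw : m * w = ab - ρ / 2 * (aa + bb)) {D K : ℝ}
    (hD : D = √((k * aa - a ^ 2) * (k * bb - b ^ 2)))
    (hK : K = ((k * aa - a ^ 2) - (k * bb - b ^ 2)) /
      (√(k * aa - a ^ 2) + √(k * bb - b ^ 2)) ^ 2) :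
    w + (k * m / D - 1) * w + ρ / 2 * (1 - K) * a / D * a
      + (ρ / 2 * (1 + K) * b - a) / D * b + ρ / 2 * K * k / D * (aa - bb)
      = corOfAverages k a b aa bb ab - ρ := by
  have hD0 : 0 < D := hD ▸ Real.sqrt_pos.2 (mul_pos hG hH)
  rw [corOfAverages, ← hD]
  rw [Real.sqrt_mul hG.le] at hD
  obtain ⟨g, hg⟩ : ∃ g, g = √(k * aa - a ^ 2) := ⟨_, rfl⟩
  obtain ⟨h, hh⟩ : ∃ h, h = √(k * bb - b ^ 2) := ⟨_, rfl⟩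
  have hg0 : 0 < g := hg ▸ Real.sqrt_pos.2 hG
  have hh0 : 0 < h := hh ▸ Real.sqrt_pos.2 hH
  have hg2 : k * aa - a ^ 2 = g ^ 2 := by rw [hg, Real.sq_sqrt hG.le]
  have hh2 : k * bb - b ^ 2 = h ^ 2 := by rw [hh, Real.sq_sqrt hH.le]
  rw [← hg, ← hh] at hD hK
  rw [hg2, hh2] at hK
  have hKmul : K * (g ^ 2 - h ^ 2) = (g - h) ^ 2 := by
    rw [hK]
    field_simp
    ring
  have key : k * (m * w) + ρ / 2 * (1 - K) * a * a + (ρ / 2 * (1 + K) * b - a) * b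
      + ρ / 2 * K * k * (aa - bb) = k * ab - a * b - ρ * D := by
    rw [hw, hD]
    linear_combination (ρ / 2) * hKmul + (ρ / 2 * K - ρ / 2) * hg2
      + (-ρ / 2 * K - ρ / 2) * hh2
  field_simp
  linear_combination 2 * key

/-! ### Limit theorems for averages -/

section Average

/-- The average of `f` over the first `n` observations. -/
def average {Ω E : Type*} (Z : ℕ → Ω → E) (f : E → ℝ) (n : ℕ) (ω : Ω) : ℝ :=
  (∑ k ∈ Finset.range n, f (Z k ω)) / n

theorem average_add {Ω E : Type*} {Z : ℕ → Ω → E} (f g : E → ℝ) (n : ℕ) (ω : Ω) :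
    average Z (fun z => f z + g z) n ω = average Z f n ω + average Z g n ω := by
  simp [average, Finset.sum_add_distrib, add_div]

theorem average_sub {Ω E : Type*} {Z : ℕ → Ω → E} (f g : E → ℝ) (n : ℕ) (ω : Ω) :
    average Z (fun z => f z - g z) n ω = average Z f n ω - average Z g n ω := by
  simp [average, Finset.sum_sub_distrib, sub_div]

theorem average_const_mul {Ω E : Type*} {Z : ℕ → Ω → E} (c : ℝ) (f : E → ℝ) (n : ℕ) (ω : Ω) :
    average Z (fun z => c * f z) n ω = c * average Z f n ω := by
  simp [average, ← Finset.mul_sum, mul_div_assoc]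

variable {Ω E : Type*} [MeasurableSpace Ω] [MeasurableSpace E] {P : Measure Ω}
  {Z : ℕ → Ω → E}

theorem aemeasurable_average (hident : ∀ i, IdentDistrib (Z i) (Z 0) P P) {f : E → ℝ}
    (hf : Measurable f) (n : ℕ) : AEMeasurable (average Z f n) P :=
  (Finset.aemeasurable_fun_sum _ fun i _ =>
    hf.comp_aemeasurable (hident i).aemeasurable_fst).div_const _

variable [IsProbabilityMeasure P]

theorem tendsto_average (hindep : iIndepFun Z P)
    (hident : ∀ i, IdentDistrib (Z i) (Z 0) P P) {f : E → ℝ} (hf : Measurable f)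
    (hint : MemLp (fun ω => f (Z 0 ω)) 2 P) :
    ∀ᵐ ω ∂P, Tendsto (fun n => average Z f n ω) atTop (𝓝 (∫ ω, f (Z 0 ω) ∂P)) :=
  strong_law_ae_real (fun i ω => f (Z i ω)) (hint.integrable (by norm_num))
    (fun _ _ hij => (hindep.comp (fun _ => f) fun _ => hf).indepFun hij)
    fun i => (hident i).comp hf

theorem tendstoInDistribution_sqrt_mul_average (hindep : iIndepFun Z P)
    (hident : ∀ i, IdentDistrib (Z i) (Z 0) P P) {f : E → ℝ} (hf : Measurable f)
    (hint : MemLp (fun ω => f (Z 0 ω)) 2 P) (h0 : ∫ ω, f (Z 0 ω) ∂P = 0) :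
    TendstoInDistribution (fun (n : ℕ) ω => √(n : ℝ) * average Z f n ω) atTop (id : ℝ → ℝ)
      (fun _ => P) (gaussianReal 0 Var[fun ω => f (Z 0 ω); P].toNNReal) := by
  have h := tendstoInDistribution_inv_sqrt_mul_sum_sub (X := fun i ω => f (Z i ω))
    (Y := (id : ℝ → ℝ)) (P' := gaussianReal 0 Var[fun ω => f (Z 0 ω); P].toNNReal)
    HasLaw.id hint (hindep.comp (fun _ => f) fun _ => hf) fun i => (hident i).comp hf
  convert h using 3 with n ω
  rw [h0, average, mul_zero, sub_zero, mul_div_assoc', mul_comm, mul_div_assoc,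
    Real.sqrt_div_self', one_div, mul_comm]

/-- Each summand of `corOfAverages_sub` other than the leading `w` is a centred average, tight after
scaling by √n, times a coefficient tending to 0. -/
theorem tendstoInDistribution_corOfAverages (hindep : iIndepFun Z P)
    (hident : ∀ i, IdentDistrib (Z i) (Z 0) P P) {k a b aa bb ab : E → ℝ}
    (hk : Measurable k) (ha : Measurable a) (hb : Measurable b) (haa : Measurable aa)
    (hbb : Measurable bb) (hab : Measurable ab)
    (ik : MemLp (fun ω => k (Z 0 ω)) 2 P) (ia : MemLp (fun ω => a (Z 0 ω)) 2 P)
    (ib : MemLp (fun ω => b (Z 0 ω)) 2 P) (iaa : MemLp (fun ω => aa (Z 0 ω)) 2 P)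
    (ibb : MemLp (fun ω => bb (Z 0 ω)) 2 P) (iab : MemLp (fun ω => ab (Z 0 ω)) 2 P)
    {m ρ : ℝ} (hm : 0 < m) (ek : ∫ ω, k (Z 0 ω) ∂P = m)
    (ea : ∫ ω, a (Z 0 ω) ∂P = 0) (eb : ∫ ω, b (Z 0 ω) ∂P = 0)
    (eaa : ∫ ω, aa (Z 0 ω) ∂P = m) (ebb : ∫ ω, bb (Z 0 ω) ∂P = m)
    (eab : ∫ ω, ab (Z 0 ω) ∂P = ρ * m) :
    TendstoInDistribution (fun (n : ℕ) ω => √(n : ℝ) *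
        (corOfAverages (average Z k n ω) (average Z a n ω) (average Z b n ω)
          (average Z aa n ω) (average Z bb n ω) (average Z ab n ω) - ρ)) atTop (id : ℝ → ℝ)
      (fun _ => P) (gaussianReal 0
        Var[fun ω => m⁻¹ * (ab (Z 0 ω) - ρ / 2 * (aa (Z 0 ω) + bb (Z 0 ω))); P].toNNReal) := by
  have Ik := ik.integrable (q := 2) (by norm_num)
  have Iaa := iaa.integrable (q := 2) (by norm_num)
  have Ibb := ibb.integrable (q := 2) (by norm_num)
  have Iab := iab.integrable (q := 2) (by norm_num)
  let w : E → ℝ := fun z => m⁻¹ * (ab z - ρ / 2 * (aa z + bb z))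
  have hw : Measurable w := (hab.sub ((haa.add hbb).const_mul _)).const_mul _
  have iw : MemLp (fun ω => w (Z 0 ω)) 2 P :=
    (iab.sub ((iaa.add ibb).const_mul _)).const_mul _
  have ew : ∫ ω, w (Z 0 ω) ∂P = 0 := by
    simp only [w]
    rw [integral_const_mul, integral_sub Iab (by exact (Iaa.add Ibb).const_mul _),
      integral_const_mul, integral_add Iaa Ibb, eab, eaa, ebb]
    ring
  have ed : ∫ ω, (aa (Z 0 ω) - bb (Z 0 ω)) ∂P = 0 := by
    rw [integral_sub Iaa Ibb, eaa, ebb, sub_self]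
  have Tw := tendstoInDistribution_sqrt_mul_average hindep hident hw iw ew
  have Ta := tendstoInDistribution_sqrt_mul_average hindep hident ha ia ea
  have Tb := tendstoInDistribution_sqrt_mul_average hindep hident hb ib eb
  have Td := tendstoInDistribution_sqrt_mul_average hindep hident (haa.sub hbb)
    (iaa.sub ibb) ed
  have Lk := tendsto_average hindep hident hk ik
  have La := tendsto_average hindep hident ha ia
  have Lb := tendsto_average hindep hident hb ib
  have Laa := tendsto_average hindep hident haa iaa
  have Lbb := tendsto_average hindep hident hbb ibb
  rw [ek] at Lk
  rw [ea] at La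
  rw [eb] at Lb
  rw [eaa] at Laa
  rw [ebb] at Lbb
  have Mk := aemeasurable_average hident hk
  have Ma := aemeasurable_average hident ha
  have Mb := aemeasurable_average hident hb
  have Maa := aemeasurable_average hident haa
  have Mbb := aemeasurable_average hident hbb
  have Mab := aemeasurable_average hident hab
  let G : ℕ → Ω → ℝ := fun n ω => average Z k n ω * average Z aa n ω - average Z a n ω ^ 2
  let H : ℕ → Ω → ℝ := fun n ω => average Z k n ω * average Z bb n ω - average Z b n ω ^ 2
  let D : ℕ → Ω → ℝ := fun n ω => √(G n ω * H n ω)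
  let K : ℕ → Ω → ℝ := fun n ω => (G n ω - H n ω) / (√(G n ω) + √(H n ω)) ^ 2
  have MG n : AEMeasurable (G n) P := ((Mk n).mul (Maa n)).sub ((Ma n).pow_const 2)
  have MH n : AEMeasurable (H n) P := ((Mk n).mul (Mbb n)).sub ((Mb n).pow_const 2)
  have MD n : AEMeasurable (D n) P := ((MG n).mul (MH n)).sqrt
  have MK n : AEMeasurable (K n) P :=
    ((MG n).sub (MH n)).div (((MG n).sqrt.add (MH n).sqrt).pow_const 2)
  have hmm : 0 < m * m := mul_pos hm hm
  have LG : ∀ᵐ ω ∂P, Tendsto (fun n => G n ω) atTop (𝓝 (m * m)) := by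
    filter_upwards [Lk, La, Laa] with ω h1 h2 h3
    simpa using (h1.mul h3).sub (h2.pow 2)
  have LH : ∀ᵐ ω ∂P, Tendsto (fun n => H n ω) atTop (𝓝 (m * m)) := by
    filter_upwards [Lk, Lb, Lbb] with ω h1 h2 h3
    simpa using (h1.mul h3).sub (h2.pow 2)
  have LD : ∀ᵐ ω ∂P, Tendsto (fun n => D n ω) atTop (𝓝 (m * m)) := by
    filter_upwards [LG, LH] with ω h1 h2
    simpa [Real.sqrt_mul_self hmm.le] using (h1.mul h2).sqrt
  have LK : ∀ᵐ ω ∂P, Tendsto (fun n => K n ω) atTop (𝓝 0) := by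
    filter_upwards [LG, LH] with ω h1 h2
    have hne : (√(m * m) + √(m * m)) ^ 2 ≠ 0 := by
      have := Real.sqrt_pos.2 hmm
      positivity
    simpa [K, Pi.div_def] using (h1.sub h2).div ((h1.sqrt.add h2.sqrt).pow 2) hne
  -- The four remainders of `corOfAverages_sub` are added one at a time; G, H and D all tend to m²,
  -- hence K tends to 0.
  have S := Tw
  replace S := TendstoInDistribution.add_mul_of_tendsto_zero S Tw
    (c := fun n ω => average Z k n ω * m / D n ω - 1)
    (fun n => (((Mk n).mul_const m).div (MD n)).sub_const 1) (by
      filter_upwards [Lk, LD] with ω h1 h2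
      simpa [hmm.ne', Pi.div_def] using ((h1.mul_const m).div h2 hmm.ne').sub_const 1)
  replace S := TendstoInDistribution.add_mul_of_tendsto_zero S Ta
    (c := fun n ω => ρ / 2 * (1 - K n ω) * average Z a n ω / D n ω)
    (fun n => ((((MK n).const_sub 1).const_mul _).mul (Ma n)).div (MD n)) (by
      filter_upwards [La, LD, LK] with ω h1 h2 h3
      simpa [Pi.div_def] using (((h3.const_sub 1).const_mul (ρ / 2)).mul h1).div h2 hmm.ne')
  replace S := TendstoInDistribution.add_mul_of_tendsto_zero S Tb
    (c := fun n ω => (ρ / 2 * (1 + K n ω) * average Z b n ω - average Z a n ω) / D n ω)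
    (fun n => (((((MK n).const_add 1).const_mul _).mul (Mb n)).sub (Ma n)).div (MD n)) (by
      filter_upwards [La, Lb, LD, LK] with ω h1 h2 h3 h4
      simpa [Pi.div_def] using ((((h4.const_add 1).const_mul (ρ / 2)).mul h2).sub h1).div h3 hmm.ne')
  replace S := TendstoInDistribution.add_mul_of_tendsto_zero S Td
    (c := fun n ω => ρ / 2 * K n ω * average Z k n ω / D n ω)
    (fun n => (((MK n).const_mul _).mul (Mk n)).div (MD n)) (by
      filter_upwards [Lk, LD, LK] with ω h1 h2 h3
      simpa [Pi.div_def] using ((h3.const_mul (ρ / 2)).mul h1).div h2 hmm.ne')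
  refine TendstoInDistribution.congr_eventually S (fun n => ?_) ?_
  · exact (((((Mk n).mul (Mab n)).sub ((Ma n).mul (Mb n))).div (MD n)).sub_const ρ).const_mul _
  -- The identity needs both variance factors positive, which holds from some n on since their limit
  -- m² is positive.
  filter_upwards [LG, LH] with ω h1 h2
  filter_upwards [h1.eventually (lt_mem_nhds hmm), h2.eventually (lt_mem_nhds hmm)] with n h3 h4
  rw [← corOfAverages_sub (D := D n ω) (K := K n ω) (w := average Z w n ω) h3 h4
    (by simp only [w, average_const_mul, average_sub, average_add]
        rw [mul_inv_cancel_left₀ hm.ne']) rfl rfl]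
  have := average_sub (Z := Z) aa bb n ω
  simp only [Pi.sub_def, this]
  ring

end Average

/-! ### Affine invariance of the sample correlation -/

section Sample

/-- The sample correlation is invariant under positive affine transformations of the
coordinates, and a function of six averages. -/
theorem sampleCor_eq_corOfAverages {n : ℕ} (A : Set (ℝ × ℝ)) {x y u v : Fin n → ℝ}
    {μ σ ν κ : ℝ} (hσ : 0 < σ) (hκ : 0 < κ) (hx : ∀ i, x i = μ + σ * u i)
    (hy : ∀ i, y i = ν + κ * v i) :
    sampleCor A x y = corOfAverages ((∑ i, ind A x y i) / n) ((∑ i, u i * ind A x y i) / n)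
      ((∑ i, v i * ind A x y i) / n) ((∑ i, u i ^ 2 * ind A x y i) / n)
      ((∑ i, v i ^ 2 * ind A x y i) / n) ((∑ i, u i * v i * ind A x y i) / n) := by
  have hnn : ∀ i, 0 ≤ ind A x y i := fun i => Set.indicator_nonneg (fun _ _ => zero_le_one) _
  -- With no observation in `A`, both sides are 0 by the convention on division by zero.
  by_cases hN : ∑ i, ind A x y i = 0
  · have h0 : ∀ i, ind A x y i = 0 := fun i =>
      (Finset.sum_eq_zero_iff_of_nonneg fun i _ => hnn i).1 hN i (Finset.mem_univ i)
    simp [sampleCor, sampleCov, corOfAverages, h0]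
  have hn : (n : ℝ) ≠ 0 := by
    rintro h
    obtain rfl : n = 0 := by exact_mod_cast h
    simp at hN
  set J := ind A x y with hJ
  obtain ⟨N, hNdef⟩ : ∃ N, N = ∑ i, J i := ⟨_, rfl⟩
  obtain ⟨a, ha⟩ : ∃ a, a = ∑ i, u i * J i := ⟨_, rfl⟩
  obtain ⟨b, hb⟩ : ∃ b, b = ∑ i, v i * J i := ⟨_, rfl⟩
  obtain ⟨aa, haa⟩ : ∃ aa, aa = ∑ i, u i ^ 2 * J i := ⟨_, rfl⟩
  obtain ⟨bb, hbb⟩ : ∃ bb, bb = ∑ i, v i ^ 2 * J i := ⟨_, rfl⟩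
  obtain ⟨ab, hab⟩ : ∃ ab, ab = ∑ i, u i * v i * J i := ⟨_, rfl⟩
  have mean : ∀ {z w : Fin n → ℝ} {m s : ℝ}, (∀ i, z i = m + s * w i) →
      sampleMean A x y z = m + s * ((∑ i, w i * J i) / N) := by
    intro z w m s hz
    have : ∑ i, z i * J i = m * N + s * ∑ i, w i * J i := by
      rw [hNdef, Finset.mul_sum, Finset.mul_sum, ← Finset.sum_add_distrib]
      exact Finset.sum_congr rfl fun i _ => by rw [hz]; ring
    rw [← hNdef] at hN
    rw [sampleMean, sampleCount, ← hJ, ← hNdef, this]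
    field_simp
  have quad : ∀ (f g : Fin n → ℝ) (c d : ℝ), ∑ i, (f i - c) * (g i - d) * J i =
      ∑ i, f i * g i * J i - d * ∑ i, f i * J i - c * ∑ i, g i * J i + c * d * N := by
    intro f g c d
    rw [hNdef, Finset.mul_sum, Finset.mul_sum, Finset.mul_sum, ← Finset.sum_sub_distrib,
      ← Finset.sum_sub_distrib, ← Finset.sum_add_distrib]
    exact Finset.sum_congr rfl fun i _ => by ring
  have mx : sampleMean A x y x = μ + σ * (a / N) := ha ▸ mean hx
  have my : sampleMean A x y y = ν + κ * (b / N) := hb ▸ mean hy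
  rw [← hNdef] at hN
  have cov : sampleCov A x y = σ * κ / N ^ 2 * (N * ab - a * b) := by
    have : ∑ i, (x i - sampleMean A x y x) * (y i - sampleMean A x y y) * J i =
        σ * κ * ∑ i, (u i - a / N) * (v i - b / N) * J i := by
      rw [mx, my, Finset.mul_sum]
      exact Finset.sum_congr rfl fun i _ => by rw [hx, hy]; ring
    rw [sampleCov, sampleCount, ← hJ, this, quad, ← hNdef, ← ha, ← hb, ← hab]
    field_simp
    ring
  have vx : sampleVar A x y x = (σ / N) ^ 2 * (N * aa - a ^ 2) := by
    have : ∑ i, (x i - sampleMean A x y x) ^ 2 * J i =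
        σ ^ 2 * ∑ i, (u i - a / N) * (u i - a / N) * J i := by
      rw [mx, Finset.mul_sum]
      exact Finset.sum_congr rfl fun i _ => by rw [hx]; ring
    rw [sampleVar, sampleCount, ← hJ, this, quad, ← hNdef, ← ha]
    simp only [← pow_two, ← haa]
    field_simp
    ring
  have vy : sampleVar A x y y = (κ / N) ^ 2 * (N * bb - b ^ 2) := by
    have : ∑ i, (y i - sampleMean A x y y) ^ 2 * J i =
        κ ^ 2 * ∑ i, (v i - b / N) * (v i - b / N) * J i := by
      rw [my, Finset.mul_sum]
      exact Finset.sum_congr rfl fun i _ => by rw [hy]; ring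
    rw [sampleVar, sampleCount, ← hJ, this, quad, ← hNdef, ← hb]
    simp only [← pow_two, ← hbb]
    field_simp
    ring
  rw [← hNdef, ← ha, ← hb, ← haa, ← hbb, ← hab, sampleCor, cov, vx, vy, corOfAverages]
  have e1 : (σ / N) ^ 2 * (N * aa - a ^ 2) * ((κ / N) ^ 2 * (N * bb - b ^ 2)) =
      (σ * κ / N ^ 2) ^ 2 * ((N * aa - a ^ 2) * (N * bb - b ^ 2)) := by ring
  have e2 : (N / n * (aa / n) - (a / n) ^ 2) * (N / n * (bb / n) - (b / n) ^ 2) =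
      (1 / (n : ℝ) ^ 2) ^ 2 * ((N * aa - a ^ 2) * (N * bb - b ^ 2)) := by ring
  have e3 : N / n * (ab / n) - a / n * (b / n) = 1 / (n : ℝ) ^ 2 * (N * ab - a * b) := by ring
  rw [e1, e2, e3, Real.sqrt_mul (sq_nonneg _), Real.sqrt_mul (sq_nonneg _),
    Real.sqrt_sq (by positivity), Real.sqrt_sq (by positivity),
    mul_div_mul_left _ _ (by positivity), mul_div_mul_left _ _ (by positivity)]

end Sample

/-! ### Conditional moments and degeneracy -/

section Population

variable {Ω : Type*} [MeasurableSpace Ω] {P : Measure Ω}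
  {X Y : Ω → ℝ} {A : Set (ℝ × ℝ)}

/-- A random variable with a continuous distribution function has no atoms. -/
theorem measure_eq_zero_of_continuous_distFun [IsProbabilityMeasure P] {Z : Ω → ℝ}
    (hZ : Measurable Z) (hF : Continuous (distFun P Z)) (c : ℝ) : P {ω | Z ω = c} = 0 := by
  have : IsProbabilityMeasure (P.map Z) := Measure.isProbabilityMeasure_map hZ.aemeasurable
  have h : (P.map Z) {c} = 0 := by
    rw [← measure_cdf (P.map Z), StieltjesFunction.measure_singleton]
    have : Function.leftLim (cdf (P.map Z)) c = cdf (P.map Z) c :=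
      (show Continuous (cdf (P.map Z)) from hF).continuousWithinAt.leftLim_eq
    simp [this]
  rwa [Measure.map_apply hZ (measurableSet_singleton c)] at h

theorem ae_condMeasure_iff [IsProbabilityMeasure P]
    (hB : MeasurableSet {ω | (X ω, Y ω) ∈ A}) {p : Ω → Prop} :
    (∀ᵐ ω ∂(condMeasure P X Y A), p ω) ↔ ∀ᵐ ω ∂P, (X ω, Y ω) ∈ A → p ω := by
  rw [condMeasure, ProbabilityTheory.cond,
    Measure.ae_ennreal_smul_measure_iff (ENNReal.inv_ne_zero.2 (measure_ne_top _ _)),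
    ae_restrict_iff' hB]
  rfl

theorem integral_indicator_comp [IsProbabilityMeasure P]
    (hB : MeasurableSet {ω | (X ω, Y ω) ∈ A})
    (hpos : 0 < P {ω | (X ω, Y ω) ∈ A}) (g : ℝ × ℝ → ℝ) :
    ∫ ω, A.indicator g (X ω, Y ω) ∂P =
      P.real {ω | (X ω, Y ω) ∈ A} * ∫ ω, g (X ω, Y ω) ∂(condMeasure P X Y A) := by
  have h1 : ∀ ω, A.indicator g (X ω, Y ω) =
      {ω | (X ω, Y ω) ∈ A}.indicator (fun ω => g (X ω, Y ω)) ω := fun ω => rfl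
  have h2 : (P {ω | (X ω, Y ω) ∈ A}).toReal ≠ 0 :=
    (ENNReal.toReal_pos hpos.ne' (measure_ne_top _ _)).ne'
  simp_rw [h1]
  rw [integral_indicator hB, condMeasure, ProbabilityTheory.cond, integral_smul_measure,
    ENNReal.toReal_inv, smul_eq_mul, Measure.real, mul_inv_cancel_left₀ h2]

theorem integrable_condMeasure (hX : Measurable X) (hY : Measurable Y) (hA : IsCompact A)
    {g : ℝ × ℝ → ℝ} (hg : Continuous g) :
    Integrable (fun ω => g (X ω, Y ω)) (condMeasure P X Y A) := by
  obtain ⟨C, hC⟩ := hA.exists_bound_of_continuousOn hg.continuousOn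
  have hB : MeasurableSet {ω | (X ω, Y ω) ∈ A} := (hX.prodMk hY) hA.measurableSet
  unfold condMeasure
  exact Integrable.of_bound (hg.measurable.comp (hX.prodMk hY)).aestronglyMeasurable C
    (ae_cond_of_forall_mem hB fun ω hω => hC _ hω)

/-- A continuous function is bounded on the compact set `A`, so no moment condition on the variables
is needed. -/
theorem memLp_indicator_comp [IsProbabilityMeasure P] {E : Ω → ℝ × ℝ} (hE : AEMeasurable E P)
    (hA : IsCompact A)
    {g : ℝ × ℝ → ℝ} (hg : Continuous g) : MemLp (fun ω => A.indicator g (E ω)) 2 P := by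
  obtain ⟨C, hC⟩ := hA.exists_bound_of_continuousOn hg.continuousOn
  refine MemLp.of_bound ((hg.measurable.indicator hA.measurableSet).comp_aemeasurable
    hE).aestronglyMeasurable (max C 0) (ae_of_all _ fun ω => ?_)
  by_cases h : E ω ∈ A
  · rw [Set.indicator_of_mem h]
    exact (hC _ h).trans (le_max_left _ _)
  · rw [Set.indicator_of_notMem h, norm_zero]
    exact le_max_right _ _

/-- A variable with continuous distribution function has positive conditional variance. -/
theorem condVar_pos [IsProbabilityMeasure P] {Z : Ω → ℝ} (hZ : Measurable Z)
    (hF : Continuous (distFun P Z))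
    (hpos : 0 < P {ω | (X ω, Y ω) ∈ A})
    (hint : Integrable (fun ω => (Z ω - condMean P X Y A Z) ^ 2) (condMeasure P X Y A)) :
    0 < condVar P X Y A Z := by
  refine lt_of_le_of_ne (integral_nonneg fun ω => sq_nonneg _) fun h => ?_
  -- Zero variance would make `Z` equal to its conditional mean almost surely on `A`, an atom that
  -- continuity excludes.
  have h0 := (integral_eq_zero_iff_of_nonneg (fun ω => sq_nonneg _) hint).1 h.symm
  have hprob : IsProbabilityMeasure (condMeasure P X Y A) := cond_isProbabilityMeasure hpos.ne'
  have hnull : condMeasure P X Y A {ω | Z ω = condMean P X Y A Z} = 0 :=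
    cond_absolutelyContinuous (measure_eq_zero_of_continuous_distFun hZ hF _)
  have hne : ∀ᵐ ω ∂(condMeasure P X Y A), Z ω ≠ condMean P X Y A Z := by
    rw [ae_iff]
    simpa using hnull
  have : ∀ᵐ ω ∂(condMeasure P X Y A), False := by
    filter_upwards [h0, hne] with ω h1 h2
    exact h2 (sub_eq_zero.1 (pow_eq_zero_iff two_ne_zero |>.1 h1))
  exact IsProbabilityMeasure.ne_zero _ (by simpa using this)

theorem integral_standardized {Z : Ω → ℝ} [IsProbabilityMeasure (condMeasure P X Y A)]
    (hint : Integrable Z (condMeasure P X Y A)) :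
    ∫ ω, standardized P X Y A Z ω ∂(condMeasure P X Y A) = 0 := by
  simp only [standardized]
  rw [integral_div, integral_sub hint (integrable_const _)]
  simp [condMean]

theorem integral_standardized_sq {Z : Ω → ℝ} (hpos : 0 < condVar P X Y A Z) :
    ∫ ω, standardized P X Y A Z ω ^ 2 ∂(condMeasure P X Y A) = 1 := by
  simp only [standardized, div_pow, Real.sq_sqrt hpos.le]
  rw [integral_div]
  exact div_self hpos.ne'

theorem integral_standardized_mul (hpos : 0 < condVar P X Y A X) :
    ∫ ω, standardized P X Y A X ω * standardized P X Y A Y ω ∂(condMeasure P X Y A) =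
      condCor P X Y A := by
  simp only [standardized, div_mul_div_comm]
  rw [integral_div, condCor, Real.sqrt_mul hpos.le, condCov]

/-- The product (v - tu)(u - tv) equals (1 + t²)uv - t(u² + v²), so the two lines form one quadratic
relation, and taking expectations forces ρ = 2t/(1 + t²). Conversely this equation has a real
solution t because |ρ| ≤ 1. -/
theorem ae_mem_lines_iff {μ : Measure Ω} [IsProbabilityMeasure μ] {U V : Ω → ℝ} {ρ : ℝ}
    (hU : ∫ ω, U ω ^ 2 ∂μ = 1) (hV : ∫ ω, V ω ^ 2 ∂μ = 1) (hUV : ∫ ω, U ω * V ω ∂μ = ρ)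
    (iUV : Integrable (fun ω => U ω * V ω) μ) :
    (∃ t : ℝ, ∀ᵐ ω ∂μ, V ω = t * U ω ∨ U ω = t * V ω) ↔
      ∀ᵐ ω ∂μ, U ω * V ω = ρ / 2 * (U ω ^ 2 + V ω ^ 2) := by
  have iU : Integrable (fun ω => U ω ^ 2) μ := .of_integral_ne_zero (by simp [hU])
  have iV : Integrable (fun ω => V ω ^ 2) μ := .of_integral_ne_zero (by simp [hV])
  have lines : ∀ t u v : ℝ, (v = t * u ∨ u = t * v) ↔ (1 + t ^ 2) * (u * v) =
      t * (u ^ 2 + v ^ 2) := by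
    intro t u v
    rw [← sub_eq_zero, ← sub_eq_zero (a := u), ← mul_eq_zero, ← sub_eq_zero (a := _ * (u * v))]
    ring_nf
  constructor
  · rintro ⟨t, ht⟩
    have ht' : ∀ᵐ ω ∂μ, (1 + t ^ 2) * (U ω * V ω) = t * (U ω ^ 2 + V ω ^ 2) := by
      filter_upwards [ht] with ω h using (lines t _ _).1 h
    have hρ : (1 + t ^ 2) * ρ = t * 2 := by
      have := integral_congr_ae ht'
      rw [integral_const_mul, integral_const_mul, integral_add iU iV, hU, hV, hUV] at this
      linarith
    have h1 : (1 + t ^ 2) ≠ 0 := by positivity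
    filter_upwards [ht'] with ω h
    refine mul_left_cancel₀ h1 ?_
    linear_combination h - (U ω ^ 2 + V ω ^ 2) / 2 * hρ
  · intro h
    -- Cauchy–Schwarz, from E(U + V)² ≥ 0 and E(U - V)² ≥ 0.
    have hρ1 : ρ ^ 2 ≤ 1 := by
      have hp : 0 ≤ ∫ ω, (U ω ^ 2 + V ω ^ 2 + 2 * (U ω * V ω)) ∂μ :=
        integral_nonneg fun ω => by
          have := sq_nonneg (U ω + V ω)
          simp only [Pi.zero_apply]
          linarith
      have hm : 0 ≤ ∫ ω, (U ω ^ 2 + V ω ^ 2 - 2 * (U ω * V ω)) ∂μ :=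
        integral_nonneg fun ω => by
          have := sq_nonneg (U ω - V ω)
          simp only [Pi.zero_apply]
          linarith
      rw [integral_add (by exact iU.add iV) (iUV.const_mul 2), integral_const_mul,
        integral_add iU iV, hU, hV, hUV] at hp
      rw [integral_sub (by exact iU.add iV) (iUV.const_mul 2), integral_const_mul,
        integral_add iU iV, hU, hV, hUV] at hm
      nlinarith
    obtain ⟨t, ht⟩ : ∃ t : ℝ, (1 + t ^ 2) * ρ = t * 2 := by
      have hs := Real.sq_sqrt (sub_nonneg.2 hρ1)
      have hs0 := Real.sqrt_nonneg (1 - ρ ^ 2)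
      -- The root of ρt² - 2t + ρ = 0 of smaller modulus, in a form that also covers ρ = 0.
      refine ⟨ρ / (1 + √(1 - ρ ^ 2)), ?_⟩
      field_simp
      linear_combination ρ * hs
    refine ⟨t, ?_⟩
    filter_upwards [h] with ω hω
    rw [lines]
    linear_combination (1 + t ^ 2) * hω + (U ω ^ 2 + V ω ^ 2) / 2 * ht

end Population

end QuantileCor

end

/-! ### The central limit theorem and the positivity of τ -/

theorem mainTheorem2 {Ω : Type*} [MeasurableSpace Ω] (P : Measure Ω) [IsProbabilityMeasure P]
    (X Y : Ω → ℝ) (hX : Measurable X) (hY : Measurable Y)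
    (hFX : QuantileCor.ContinuousInvertible P X) (hFY : QuantileCor.ContinuousInvertible P Y)
    (p₁ q₁ p₂ q₂ : ℝ) (hp₁ : 0 < p₁) (hpq₁ : p₁ < q₁) (hq₁ : q₁ < 1)
    (hp₂ : 0 < p₂) (hpq₂ : p₂ < q₂) (hq₂ : q₂ < 1)
    (A : Set (ℝ × ℝ)) (hA : A = QuantileCor.quantileSet P X Y p₁ q₁ p₂ q₂)
    (hpos : 0 < P {ω | (X ω, Y ω) ∈ A})
    (Xs Ys : ℕ → Ω → ℝ)
    (hindep : iIndepFun (fun i ω => (Xs i ω, Ys i ω)) P)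
    (hident : ∀ i, IdentDistrib (fun ω => (Xs i ω, Ys i ω)) (fun ω => (X ω, Y ω)) P P) :
    ∃ τ : NNReal,
      TendstoInDistribution
        (fun (n : ℕ) (ω : Ω) =>
          √(n : ℝ) *
            (QuantileCor.sampleCor A (fun i : Fin n => Xs i ω) (fun i : Fin n => Ys i ω) -
              QuantileCor.condCor P X Y A))
        atTop (id : ℝ → ℝ) (fun _ => P) (gaussianReal 0 τ) ∧
      (0 < τ ↔ ¬ QuantileCor.Degenerate P X Y A) := by
  have hAc : IsCompact A := hA ▸ isCompact_Icc.prod isCompact_Icc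
  have hB : MeasurableSet {ω | (X ω, Y ω) ∈ A} := (hX.prodMk hY) hAc.measurableSet
  have hprob : IsProbabilityMeasure (QuantileCor.condMeasure P X Y A) :=
    cond_isProbabilityMeasure hpos.ne'
  have int {g : ℝ × ℝ → ℝ} (hg : Continuous g) :
      Integrable (fun ω => g (X ω, Y ω)) (QuantileCor.condMeasure P X Y A) :=
    QuantileCor.integrable_condMeasure hX hY hAc hg
  have vX : 0 < QuantileCor.condVar P X Y A X := QuantileCor.condVar_pos hX hFX.1 hpos
    (int (g := fun z => (z.1 - QuantileCor.condMean P X Y A X) ^ 2) (by fun_prop))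
  have vY : 0 < QuantileCor.condVar P X Y A Y := QuantileCor.condVar_pos hY hFY.1 hpos
    (int (g := fun z => (z.2 - QuantileCor.condMean P X Y A Y) ^ 2) (by fun_prop))
  have sX := Real.sqrt_pos.2 vX
  have sY := Real.sqrt_pos.2 vY
  let u : ℝ × ℝ → ℝ := fun z =>
    (z.1 - QuantileCor.condMean P X Y A X) / √(QuantileCor.condVar P X Y A X)
  let v : ℝ × ℝ → ℝ := fun z =>
    (z.2 - QuantileCor.condMean P X Y A Y) / √(QuantileCor.condVar P X Y A Y)
  have cu : Continuous u := by fun_prop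
  have cv : Continuous v := by fun_prop
  let Z : ℕ → Ω → ℝ × ℝ := fun i ω => (Xs i ω, Ys i ω)
  have hZ : ∀ i, IdentDistrib (Z i) (Z 0) P P := fun i => (hident i).trans (hident 0).symm
  have meas {g : ℝ × ℝ → ℝ} (hg : Continuous g) : Measurable (A.indicator g) :=
    hg.measurable.indicator hAc.measurableSet
  have memLp {g : ℝ × ℝ → ℝ} (hg : Continuous g) :
      MemLp (fun ω => A.indicator g (Z 0 ω)) 2 P :=
    QuantileCor.memLp_indicator_comp (hident 0).aemeasurable_fst hAc hg
  set m := P.real {ω | (X ω, Y ω) ∈ A} with hm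
  have hm0 : 0 < m := ENNReal.toReal_pos hpos.ne' (measure_ne_top _ _)
  set ρ := QuantileCor.condCor P X Y A
  have eval {g : ℝ × ℝ → ℝ} (hg : Continuous g) : ∫ ω, A.indicator g (Z 0 ω) ∂P =
      m * ∫ ω, g (X ω, Y ω) ∂(QuantileCor.condMeasure P X Y A) := by
    rw [hm, ← QuantileCor.integral_indicator_comp hB hpos]
    exact ((hident 0).comp (meas hg)).integral_eq
  have EU : ∫ ω, u (X ω, Y ω) ∂(QuantileCor.condMeasure P X Y A) = 0 :=
    QuantileCor.integral_standardized (int (g := Prod.fst) continuous_fst)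
  have EV : ∫ ω, v (X ω, Y ω) ∂(QuantileCor.condMeasure P X Y A) = 0 :=
    QuantileCor.integral_standardized (int (g := Prod.snd) continuous_snd)
  have EUU : ∫ ω, u (X ω, Y ω) ^ 2 ∂(QuantileCor.condMeasure P X Y A) = 1 :=
    QuantileCor.integral_standardized_sq vX
  have EVV : ∫ ω, v (X ω, Y ω) ^ 2 ∂(QuantileCor.condMeasure P X Y A) = 1 :=
    QuantileCor.integral_standardized_sq vY
  have EUV : ∫ ω, u (X ω, Y ω) * v (X ω, Y ω) ∂(QuantileCor.condMeasure P X Y A) = ρ :=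
    QuantileCor.integral_standardized_mul vX
  have hk : Continuous (fun _ : ℝ × ℝ => (1 : ℝ)) := continuous_const
  have lim := QuantileCor.tendstoInDistribution_corOfAverages (Z := Z) hindep hZ (meas hk) (meas cu)
    (meas cv) (meas (cu.pow 2)) (meas (cv.pow 2)) (meas (cu.mul cv)) (memLp hk) (memLp cu)
    (memLp cv) (memLp (cu.pow 2)) (memLp (cv.pow 2)) (memLp (cu.mul cv)) hm0
    (by rw [eval hk]; simp) (by rw [eval cu, EU, mul_zero]) (by rw [eval cv, EV, mul_zero])
    (by rw [eval (cu.pow 2)]; simp only [Pi.pow_apply, EUU, mul_one])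
    (by rw [eval (cv.pow 2)]; simp only [Pi.pow_apply, EVV, mul_one])
    (ρ := ρ) (by rw [eval (cu.mul cv)]; simp only [Pi.mul_apply, EUV, mul_comm])
  -- Restricted to `A`, this is the influence function of the correlation; its variance is τ.
  let g : ℝ × ℝ → ℝ := fun z => m⁻¹ * (u z * v z - ρ / 2 * (u z ^ 2 + v z ^ 2))
  have cg : Continuous g := by fun_prop
  have hgA (z : ℝ × ℝ) : m⁻¹ * (A.indicator (u * v) z -
      ρ / 2 * (A.indicator (u ^ 2) z + A.indicator (v ^ 2) z)) = A.indicator g z := by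
    by_cases hz : z ∈ A <;> simp [g, hz]
  simp only [hgA] at lim
  refine ⟨Var[fun ω => A.indicator g (Z 0 ω); P].toNNReal, ?_, ?_⟩
  · convert lim using 4 with n ω
    rw [QuantileCor.sampleCor_eq_corOfAverages A sX sY
      (u := fun i : Fin n => u (Z i ω)) (v := fun i : Fin n => v (Z i ω))
      (μ := QuantileCor.condMean P X Y A X) (ν := QuantileCor.condMean P X Y A Y)
      (fun i => by simp only [u, Z]; field_simp; ring)
      (fun i => by simp only [v, Z]; field_simp; ring)]
    have avg (g : ℝ × ℝ → ℝ) : QuantileCor.average Z (A.indicator g) n ω =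
        (∑ i : Fin n, g (Z i ω) * QuantileCor.ind A (fun i : Fin n => Xs i ω)
          (fun i : Fin n => Ys i ω) i) / n := by
      rw [QuantileCor.average, Finset.sum_range]
      congr 1
      refine Finset.sum_congr rfl fun i _ => ?_
      by_cases hi : (Xs i ω, Ys i ω) ∈ A <;> simp [QuantileCor.ind, Z, hi]
    simp only [avg, one_mul]
    rfl
  · have hvar : Var[fun ω => A.indicator g (Z 0 ω); P] =
        Var[fun ω => A.indicator g (X ω, Y ω); P] := ((hident 0).comp (meas cg)).variance_eq
    have deg : QuantileCor.Degenerate P X Y A ↔ ∀ᵐ ω ∂P, A.indicator g (X ω, Y ω) = 0 := by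
      refine (QuantileCor.ae_mem_lines_iff EUU EVV EUV (int (cu.mul cv))).trans ?_
      rw [QuantileCor.ae_condMeasure_iff hB]
      refine eventually_congr (ae_of_all _ fun ω => ?_)
      by_cases hω : (X ω, Y ω) ∈ A <;> simp [g, hω, hm0.ne', sub_eq_zero]
    have hmem : MemLp (fun ω => A.indicator g (X ω, Y ω)) 2 P :=
      QuantileCor.memLp_indicator_comp (hX.prodMk hY).aemeasurable hAc cg
    -- Zero variance only gives an almost surely constant variable; mean 0 makes that constant 0.
    have hmean : ∫ ω, A.indicator g (X ω, Y ω) ∂P = 0 := by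
      have iu := int (cu.pow 2)
      have iv := int (cv.pow 2)
      have iuv := int (cu.mul cv)
      simp only [Pi.pow_apply, Pi.mul_apply] at iu iv iuv
      rw [QuantileCor.integral_indicator_comp hB hpos]
      simp only [g]
      rw [integral_const_mul, integral_sub iuv (by exact (iu.add iv).const_mul _),
        integral_const_mul, integral_add iu iv, EUU, EVV, EUV]
      ring
    rw [Real.toNNReal_pos, hvar, deg, (variance_nonneg _ _).lt_iff_ne, not_iff_not, eq_comm]
    constructor
    · intro h
      simpa only [hmean] using ae_eq_integral_of_variance_eq_zero hmem h
    · intro h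
      rw [variance_congr (Y := 0) h, variance_zero]
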